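/- Let $S$ be a finite set of at least two strings over a totally ordered alphabet, none of which is a substring of another. For strings $u,v$ let $\mathrm{ov}(u,v)$ be the longest suffix of $u$ that is also a prefix of $v$, and let $\mathrm{pref}(u,v)$ be the string with $u=\mathrm{pref}(u,v)\,\mathrm{ov}(u,v)$. The prefix graph (respectively, overlap graph) of a finite set of strings is the complete directed graph without loops on it, in which the edge $(u,v)$ has weight $|\mathrm{pref}(u,v)|$ (respectively, $|\mathrm{ov}(u,v)|$). A cycle cover is a set of simple cycles, each through at least two vertices, such that every vertex lies on exactly one of them; its weight is the sum of the weights of all edges of its cycles. Let $\mathrm{OPT}(S)$ be the length of a shortest string that contains every string of $S$ as a substring. Let $\mathcal{C}_{\min}$ be a minimum weight cycle cover of the prefix graph of $S$, and let $w(\mathcal{C}_{\min})$ be its weight. For a cycle $C=s_1\to\dots\to s_k\to s_1$ in $\mathcal{C}_{\min}$ put $s(C)=\mathrm{pref}(s_1,s_2)\,\mathrm{pref}(s_2,s_3)\cdots\mathrm{pref}(s_k,s_1)$. Let $w(C)$ be the nice rotation of $s(C)$: if the lexicographically minimal and maximal rotations of $s(C)$ are $pq$ and $qp$, respectively, it is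 $qp$ when $|q|\le|p|$ and $pq$ otherwise. For each $C\in\mathcal{C}_{\min}$ let $R(C)$ be a representative string of $C$, that is, a string that contains all strings of $C$ as substrings, is a prefix of the infinite string $w(C)w(C)w(C)\cdots$, and is, for some $j$, a substring of $$\langle s_j,\dots,s_k,s_1,\dots,s_j\rangle=\mathrm{pref}(s_j,s_{j+1})\cdots\mathrm{pref}(s_k,s_1)\cdots\mathrm{pref}(s_{j-1},s_j)\,s_j .$$ Let $R=\{R(C):C\in\mathcal{C}_{\min}\}$. For a cycle cover $\mathcal{C}$ of the overlap graph of $R$ let $O_{\mathcal{C}}$ be the sum of the weights of all edges of the cycles of $\mathcal{C}$, and let $M_{\mathcal{C}}$ be the sum, over the cycles of $\mathcal{C}$, of the minimum weight of an edge of the cycle. Then $11\,w(\mathcal{C}_{\min})\le 11\,\mathrm{OPT}(S)$, and every maximum weight cycle cover $\mathcal{C}$ of the overlap graph of $R$ satisfies $$2M_{\mathcal{C}}+7O_{\mathcal{C}}\le 11\,w(\mathcal{C}_{\min})\le 11\,\mathrm{OPT}(S).$$ -/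

import Mathlib

/-! Strings over an ordered alphabet `α` are lists `List α`. -/

namespace Superstring

section Strings

variable {α : Type*}

/-- `x` is a `w`-string: a prefix of the semi-infinite string `w w w …`. -/
def IsWString (w x : List α) : Prop :=
  ∃ n : ℕ, x <+: (List.replicate n w).flatten

/-- Length of a shortest common superstring of the finite set `S` of strings. -/
noncomputable def OPT (S : Finset (List α)) : ℕ :=
  sInf {n : ℕ | ∃ t : List α, t.length = n ∧ ∀ s ∈ S, s <:+: t}

section Overlap

variable [DecidableEq α]

/-- `ov u v`: the longest suffix of `u` that is also a prefix of `v`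
(the suffixes of `u` are tried from the longest to the shortest). -/
def ov : List α → List α → List α
  | [], _ => []
  | a :: u, v => if (a :: u) <+: v then a :: u else ov u v

theorem ov_suffix (u v : List α) : ov u v <:+ u := by
  induction u with
  | nil => exact List.suffix_refl _
  | cons a u ih =>
    unfold ov
    split_ifs
    · exact List.suffix_refl _
    · exact ih.trans (List.suffix_cons a u)

theorem ov_prefix (u v : List α) : ov u v <+: v := by
  induction u with
  | nil => exact List.nil_prefix
  | cons a u ih =>
    unfold ov
    split_ifs with h
    · exact h
    · exact ih

theorem length_le_length_ov {u v t : List α} (hs : t <:+ u) (hp : t <+: v) :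
    t.length ≤ (ov u v).length := by
  induction u with
  | nil => simp [List.suffix_nil.mp hs]
  | cons a u ih =>
    unfold ov
    split_ifs with h
    · exact hs.length_le
    · rcases List.suffix_cons_iff.mp hs with rfl | hs'
      · exact absurd hp h
      · exact ih hs'

/-- `pref u v`: the part of `u` that does not overlap `v`, so that `u = pref u v ++ ov u v`. -/
def pref (u v : List α) : List α :=
  u.take (u.length - (ov u v).length)

theorem pref_append_ov (u v : List α) : pref u v ++ ov u v = u := by
  have h := List.suffix_iff_eq_drop.mp (ov_suffix u v)
  calc pref u v ++ ov u v
      = u.take (u.length - (ov u v).length) ++ u.drop (u.length - (ov u v).length) :=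
        congrArg (pref u v ++ ·) h
    _ = u := List.take_append_drop _ _

/-- `⟨s₁, …, sₙ⟩ = pref(s₁,s₂) pref(s₂,s₃) … pref(sₙ₋₁,sₙ) sₙ`. -/
def glue : List (List α) → List α
  | [] => []
  | [s] => s
  | s :: t :: r => pref s t ++ glue (t :: r)

/-- `s(C) = pref(s₁,s₂) pref(s₂,s₃) … pref(sₖ,s₁)` for the cycle `C = s₁ → … → sₖ → s₁`,
broken so that it starts with the first element of the list. -/
def cycleString (l : List (List α)) : List α :=
  (List.zipWith pref l (l.rotate 1)).flatten

end Overlap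

section NiceRotation

variable [LinearOrder α]

/-- `v` is the lexicographically minimal rotation of `w`. -/
def IsMinRotation (w v : List α) : Prop :=
  v ~r w ∧ ∀ z : List α, z ~r w → v ≤ z

/-- `v` is the lexicographically maximal rotation of `w`. -/
def IsMaxRotation (w v : List α) : Prop :=
  v ~r w ∧ ∀ z : List α, z ~r w → z ≤ v

/-- `v` is the nice rotation of `w`. Here `p = p_min(w)` and `q = p_max(w)` are the strings with
`w_min = p q` and `w_max = q p`; the nice rotation is `w_max` if `|q| ≤ |p|`, and `w_min`
otherwise. (For primitive `w` with `|w| ≥ 2` the strings `p`, `q` and hence `v` are unique.) -/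
def IsNiceRotation (w v : List α) : Prop :=
  ∃ p q : List α, IsMinRotation w (p ++ q) ∧ IsMaxRotation w (q ++ p) ∧
    ((q.length ≤ p.length ∧ v = q ++ p) ∨ (p.length < q.length ∧ v = p ++ q))

end NiceRotation

end Strings

section Cycles

variable {β : Type*}

/-- The edges `s₁ → s₂, …, sₖ₋₁ → sₖ, sₖ → s₁` of the cycle `s₁ → … → sₖ → s₁`. -/
def edges (C : Cycle β) : Multiset (β × β) :=
  Quotient.liftOn C (fun l => ((l.zip (l.rotate 1) : List (β × β)) : Multiset (β × β))) (by
    rintro l _ ⟨n, rfl⟩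
    refine Multiset.coe_eq_coe.mpr ?_
    have h : (l.rotate n).zip ((l.rotate n).rotate 1) = (l.zip (l.rotate 1)).rotate n := by
      rw [List.rotate_rotate, Nat.add_comm, ← List.rotate_rotate]
      exact (List.zipWith_rotate_distrib Prod.mk l (l.rotate 1) n (by simp)).symm
    rw [h]
    exact (List.rotate_perm _ _).symm)

/-- Cycle covers of the complete directed graph (without loops) on the vertex set `V`: sets of
simple cycles through at least two vertices such that every vertex of `V` lies on exactly one
of the cycles. -/
def IsCycleCover (V : Finset β) (𝒞 : Finset (Cycle β)) : Prop :=
  (∀ C ∈ 𝒞, C.Nodup ∧ C.Nontrivial ∧ ∀ v ∈ C, v ∈ V) ∧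
    ∀ v ∈ V, ∃! C : Cycle β, C ∈ 𝒞 ∧ v ∈ C

/-- Sum of the weights of the edges of a cycle, for the edge weights `f`. -/
def cycleWeight (f : β → β → ℕ) (C : Cycle β) : ℕ :=
  ((edges C).map fun e => f e.1 e.2).sum

/-- Minimum weight of an edge of a cycle, for the edge weights `f`. -/
noncomputable def minEdge (f : β → β → ℕ) (C : Cycle β) : ℕ :=
  sInf {n : ℕ | ∃ e ∈ edges C, n = f e.1 e.2}

/-- Total weight of a collection of cycles. -/
def coverWeight (f : β → β → ℕ) (𝒞 : Finset (Cycle β)) : ℕ :=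
  ∑ C ∈ 𝒞, cycleWeight f C

/-- Minimum weight cycle covers of the complete directed graph on `V` with edge weights `f`. -/
def IsMinCycleCover (f : β → β → ℕ) (V : Finset β) (𝒞 : Finset (Cycle β)) : Prop :=
  IsCycleCover V 𝒞 ∧ ∀ 𝒟, IsCycleCover V 𝒟 → coverWeight f 𝒞 ≤ coverWeight f 𝒟

/-- Maximum weight cycle covers of the complete directed graph on `V` with edge weights `f`. -/
def IsMaxCycleCover (f : β → β → ℕ) (V : Finset β) (𝒞 : Finset (Cycle β)) : Prop :=
  IsCycleCover V 𝒞 ∧ ∀ 𝒟, IsCycleCover V 𝒟 → coverWeight f 𝒟 ≤ coverWeight f 𝒞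

end Cycles

section Reduction

variable {α : Type*}

/-- Edge weights of the overlap graph: `|ov(u,v)|`. -/
def ovLen [DecidableEq α] (u v : List α) : ℕ := (ov u v).length

/-- Edge weights of the prefix (distance) graph: `|pref(u,v)|`. -/
def prefLen [DecidableEq α] (u v : List α) : ℕ := (pref u v).length

/-- `O_𝒞`: the sum over the cycles of `𝒞` of their total overlaps. -/
def totalOverlap [DecidableEq α] (𝒞 : Finset (Cycle (List α))) : ℕ :=
  ∑ C ∈ 𝒞, cycleWeight ovLen C

/-- `M_𝒞`: the sum over the cycles of `𝒞` of the smallest overlap on the cycle. -/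
noncomputable def totalMinOverlap [DecidableEq α] (𝒞 : Finset (Cycle (List α))) : ℕ :=
  ∑ C ∈ 𝒞, minEdge ovLen C

/-- `w = w(C)`: the nice rotation of `s(C)`. It does not matter where `C` is broken, since this
only rotates `s(C)`. -/
def IsNiceStringOf [LinearOrder α] (C : Cycle (List α)) (w : List α) : Prop :=
  ∃ l : List (List α), (l : Cycle (List α)) = C ∧ IsNiceRotation (cycleString l) w

/-- `x` is a representative string `R(C)` of the cycle `C`: it contains all strings of `C` as
substrings, it is a substring of `⟨sⱼ, sⱼ₊₁, …, sⱼ₋₁, sⱼ⟩` for some starting point `sⱼ` of the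
cycle, and it is a `w(C)`-string. -/
def IsRepresentative [LinearOrder α] (C : Cycle (List α)) (x : List α) : Prop :=
  (∀ s ∈ C, s <:+: x) ∧
  (∃ l : List (List α), (l : Cycle (List α)) = C ∧ x <:+: glue (l ++ l.take 1)) ∧
  ∃ w : List α, IsNiceStringOf C w ∧ IsWString w x

end Reduction

end Superstring

/-! The representative of a cycle `C` of the minimum cover is a prefix of the infinite repetition of
a nice rotation of length `d = w(C)`. Strings that are all factors of a word of period `d` lie on
one cycle of weight at most `d` in the prefix graph (`exists_cycle_of_occurs`). By minimality of the
cover, the nice rotations are therefore primitive and pairwise not conjugate, and applied to a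
shortest superstring the same fact gives `w(Cmin) ≤ OPT(S)`.

It remains to bound overlaps. An overlap on an edge `i → j` is a prefix of the periodic word of `j`
and a factor of that of `i`. Let `r j ≤ d j / 2` be the distance between the extremal rotations, one
of which starts the nice rotation. Comparing the first letters at which a shift fails with the
minimality and maximality of these rotations shows that the overlap is

* less than `d i + r j` (`occurs_lt_add`),
* less than `d j` when `d i ≤ d j` (`occurs_lt_of_le`),
* at most `d i + d j - r i` when `d j < d i`, except in a situation that needs `d i` to be about
  `2 * d j` or more and allows at most `r j` additional letters (`occurs_down`).

The third bound competes with the first one on the preceding edge: a large `r i` helps the overlap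
into `i` and harms the one out of `i`. With these bounds, `2 M + 7 O ≤ 11 ∑ d` is
a linear inequality on every single cycle. The first bound alone suffices for six or more vertices;
shorter cycles start at a vertex of largest period and are finite linear programs
(`OverlapBounds.cycle`). -/

namespace Superstring

/-! ### Overlaps of periodic words -/

section PeriodicWords

variable {α : Type*}

/-- The two-sided infinite word `W` has least period `d`, so that `d` consecutive letters of `W`
form a primitive word. -/
structure HasMinPeriod (W : ℤ → α) (d : ℤ) : Prop where
  pos : 0 < d
  periodic : ∀ n, W (n + d) = W n
  minimal : ∀ e, 0 < e → e < d → ∃ n, W (n + e) ≠ W n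

variable {V W : ℤ → α} {d D m M r ρ : ℤ}

theorem HasMinPeriod.add_mul (h : HasMinPeriod W d) (n k : ℤ) : W (n + k * d) = W n := by
  have h1 : Function.Periodic W d := h.periodic
  simpa using h1.int_mul k n

theorem HasMinPeriod.shift (h : HasMinPeriod W d) (a : ℤ) :
    HasMinPeriod (fun n => W (a + n)) d where
  pos := h.pos
  periodic n := by rw [← add_assoc]; exact h.periodic _
  minimal e h0 h1 := by
    obtain ⟨n, hn⟩ := h.minimal e h0 h1
    refine ⟨n - a, ?_⟩
    rwa [show a + (n - a + e) = n + e by ring, show a + (n - a) = n by ring]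

theorem HasMinPeriod.dual (h : HasMinPeriod W d) :
    HasMinPeriod (fun n => OrderDual.toDual (W n)) d :=
  ⟨h.pos, h.periodic, h.minimal⟩

/-- A shift that is not a period of a periodic word first fails somewhere to the right of any
given position. -/
theorem HasMinPeriod.exists_break (h : HasMinPeriod W d) {e : ℤ} (he : ∃ n, W (n + e) ≠ W n)
    (a : ℤ) : ∃ b, a ≤ b ∧ W b ≠ W (b + e) ∧ ∀ s, a ≤ s → s < b → W s = W (s + e) := by
  obtain ⟨n, hn⟩ := he
  have hex : ∃ k : ℕ, W (a + k) ≠ W (a + k + e) := by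
    refine ⟨((n - a) % d).toNat, ?_⟩
    rw [Int.toNat_of_nonneg (Int.emod_nonneg _ h.pos.ne')]
    have h2 : n = a + (n - a) % d + (n - a) / d * d := by
      have := Int.emod_add_mul_ediv (n - a) d
      linarith [mul_comm ((n - a) / d) d]
    intro h3
    apply hn
    rw [← h.add_mul (a + (n - a) % d) ((n - a) / d), ← h2] at h3
    have h4 := h.add_mul (a + (n - a) % d + e) ((n - a) / d)
    rw [show a + (n - a) % d + e + (n - a) / d * d = n + e by linarith] at h4
    rw [h4, h3]
  classical
  refine ⟨a + (Nat.find hex : ℕ), by omega, Nat.find_spec hex, fun s h1 h2 => ?_⟩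
  have := Nat.find_min hex (m := (s - a).toNat) (by omega)
  rw [Int.toNat_of_nonneg (by omega)] at this
  simpa using this

/-- `V` is a shift of `W`; for periodic words, the periods are conjugate. -/
def IsShiftOf (V W : ℤ → α) : Prop := ∃ a, ∀ n, W (a + n) = V n

/-- The first `l` letters of `V`, read from position `0`, occur in `W`. -/
def OccursUpTo (V W : ℤ → α) (l : ℤ) : Prop := ∃ a, ∀ t, 0 ≤ t → t < l → W (a + t) = V t

theorem eq_of_agree {e : ℤ} (he : 0 < e) (hV : ∀ n, V (n + e) = V n) (hW : ∀ n, W (n + e) = W n)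
    (h : ∀ t, 0 ≤ t → t < e → W t = V t) (n : ℤ) : W n = V n := by
  have h1 : Function.Periodic W e := hW
  have h2 : Function.Periodic V e := hV
  have h3 : n % e + n / e * e = n := by
    have := Int.emod_add_mul_ediv n e
    linarith [mul_comm (n / e) e]
  have h4 := h1.int_mul (n / e) (n % e)
  have h5 := h2.int_mul (n / e) (n % e)
  simp only [Int.cast_id, h3] at h4 h5
  rw [h4, h5]
  exact h _ (Int.emod_nonneg _ he.ne') (Int.emod_lt_of_pos _ he)

theorem HasMinPeriod.period_on_occurrence (hW : HasMinPeriod W D) {a l : ℤ}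
    (h : ∀ t, 0 ≤ t → t < l → W (a + t) = V t) (s : ℤ) (h0 : 0 ≤ s) (h1 : s + D < l) :
    V s = V (s + D) := by
  rw [← h s h0 (by linarith [hW.pos]), ← h (s + D) (by linarith [hW.pos]) h1, ← add_assoc,
    hW.periodic]

variable [LinearOrder α]

/-- The word `W` read from position `m` on is lexicographically minimal among its shifts. The order
is expressed by the first position `b` at which the shift by `x` may differ, positions being
absolute. -/
def IsMinAt (W : ℤ → α) (m : ℤ) : Prop :=
  ∀ x b, m ≤ b → (∀ s, m ≤ s → s < b → W s = W (s + x)) → W b ≤ W (b + x)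

/-- The word `W` read from position `m` on is lexicographically maximal among its shifts. -/
def IsMaxAt (W : ℤ → α) (m : ℤ) : Prop :=
  ∀ x b, m ≤ b → (∀ s, m ≤ s → s < b → W s = W (s + x)) → W (b + x) ≤ W b

theorem IsMinAt.shift (h : IsMinAt W m) (a : ℤ) : IsMinAt (fun n => W (a + n)) (m - a) := by
  intro x b hb hs
  have := h x (a + b) (by linarith) (fun s h1 h2 => by
    have := hs (s - a) (by linarith) (by linarith)
    simpa [add_assoc, show a + (s - a + x) = s + x by ring] using this)
  simpa [add_assoc] using this

theorem IsMinAt.dual (h : IsMinAt W m) : IsMaxAt (fun n => OrderDual.toDual (W n)) m :=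
  fun x b hb hs => h x b hb hs

theorem IsMaxAt.dual (h : IsMaxAt W m) : IsMinAt (fun n => OrderDual.toDual (W n)) m :=
  fun x b hb hs => h x b hb hs

theorem IsMaxAt.shift (h : IsMaxAt W m) (a : ℤ) : IsMaxAt (fun n => W (a + n)) (m - a) :=
  (h.dual.shift a).dual

theorem IsMinAt.add_mul (h : IsMinAt W m) (hW : HasMinPeriod W d) (k : ℤ) :
    IsMinAt W (m + k * d) := by
  have := h.shift (-(k * d))
  have h2 : (fun n => W (-(k * d) + n)) = W := by
    funext n
    have := hW.add_mul (-(k * d) + n) k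
    rw [← this]; congr 1; ring
  rw [h2] at this
  convert this using 1; ring

theorem IsMaxAt.add_mul (h : IsMaxAt W m) (hW : HasMinPeriod W d) (k : ℤ) :
    IsMaxAt W (m + k * d) :=
  (h.dual.add_mul hW.dual k).dual

theorem IsMinAt.exists_break (hm : IsMinAt W m) (h : HasMinPeriod W d) {e : ℤ}
    (he : ∃ n, W (n + e) ≠ W n) : ∃ b, m ≤ b ∧ W b < W (b + e) ∧
      ∀ s, m ≤ s → s < b → W s = W (s + e) := by
  obtain ⟨b, h1, h2, h3⟩ := h.exists_break he m
  exact ⟨b, h1, lt_of_le_of_ne (hm e b h1 h3) h2, h3⟩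

/-- Lyndon words are unbordered: the minimal rotation, compared with the word read `c` letters
later, is exceeded before the first period is over. -/
theorem IsMinAt.exists_lt (hm : IsMinAt V m) (h : HasMinPeriod V d) {c : ℤ} (h0 : 0 < c)
    (h1 : c < d) : ∃ t, m ≤ t ∧ t + c < m + d ∧ V t < V (t + c) ∧
      ∀ s, m ≤ s → s < t → V s = V (s + c) := by
  obtain ⟨b, hb, hlt, hs⟩ := hm.exists_break h (h.minimal c h0 h1)
  refine ⟨b, hb, ?_, hlt, hs⟩
  by_contra hcon
  push Not at hcon
  obtain ⟨b', hb', hlt', hs'⟩ := hm.exists_break h (h.minimal (d - c) (by omega) (by omega))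
  have h2 := hm c (b' + (d - c)) (by omega) (fun s hs1 hs2 => by
    rcases lt_or_ge s b with h3 | h3
    · exact hs s hs1 h3
    · have h4 := hs' (s - (d - c)) (by omega) (by omega)
      have h5 := h.periodic (s - (d - c))
      rw [show s - (d - c) + (d - c) = s by ring] at h4
      rw [show s - (d - c) + d = s + c by ring] at h5
      rw [h5, h4])
  rw [show b' + (d - c) + c = b' + d by ring, h.periodic] at h2
  exact absurd hlt' (not_lt.mpr h2)

theorem IsMaxAt.exists_gt (hm : IsMaxAt V m) (h : HasMinPeriod V d) {c : ℤ} (h0 : 0 < c)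
    (h1 : c < d) : ∃ t, m ≤ t ∧ t + c < m + d ∧ V (t + c) < V t ∧
      ∀ s, m ≤ s → s < t → V s = V (s + c) :=
  hm.dual.exists_lt h.dual h0 h1

/-- `W`, of least period `d`, is read from a nice rotation: positions `0` and `r` are the minimal
and the maximal one, in one order or the other, and `r` is at most half the period. -/
structure IsNiceWord (W : ℤ → α) (d r : ℤ) : Prop extends HasMinPeriod W d where
  nonneg : 0 ≤ r
  two_mul_le : 2 * r ≤ d
  extremal : (IsMinAt W 0 ∧ IsMaxAt W r) ∨ (IsMaxAt W 0 ∧ IsMinAt W r)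

theorem IsNiceWord.dual (h : IsNiceWord W d r) :
    IsNiceWord (fun n => OrderDual.toDual (W n)) d r :=
  ⟨h.toHasMinPeriod.dual, h.nonneg, h.two_mul_le,
    h.extremal.symm.imp (fun h => ⟨h.1.dual, h.2.dual⟩) (fun h => ⟨h.1.dual, h.2.dual⟩)⟩

/-- If the period `D` of `W` fails in `V`, then it first fails by a rise, `0` being minimal; past
the maximal position `r` the first failure would have to be a fall. -/
theorem occurs_lt_add_of_min (hW : HasMinPeriod W D) (hV : HasMinPeriod V d) (h0 : IsMinAt V 0)
    (hr : IsMaxAt V r) (hr0 : 0 ≤ r) (hc : ¬ IsShiftOf V W) {l : ℤ} (hl : OccursUpTo V W l) :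
    l < D + r := by
  obtain ⟨a, ha⟩ := hl
  by_contra hcon
  push Not at hcon
  have hD := hW.pos
  by_cases hp : ∃ n, V (n + D) ≠ V n
  · obtain ⟨b, hb, hlt, hs⟩ := h0.exists_break hV hp
    have hb2 : r ≤ b := by
      by_contra hb2
      exact hlt.ne (hW.period_on_occurrence ha b hb (by omega))
    exact absurd hlt (not_lt.mpr (hr D b hb2 (fun s h1 h2 => hs s (by omega) h2)))
  · push Not at hp
    exact hc ⟨a, eq_of_agree hD hp (hW.shift a).periodic (fun t h1 h2 => ha t h1 (by omega))⟩

theorem occurs_lt_add (hW : HasMinPeriod W D) (hV : IsNiceWord V d r) (hc : ¬ IsShiftOf V W) {l : ℤ}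
    (hl : OccursUpTo V W l) : l < D + r := by
  rcases hV.extremal with h | h
  · exact occurs_lt_add_of_min hW hV.toHasMinPeriod h.1 h.2 hV.nonneg hc hl
  · exact occurs_lt_add_of_min hW.dual hV.toHasMinPeriod.dual h.1.dual h.2.dual hV.nonneg hc hl

/-- A full period of `V` inside `W` would be a Lyndon word with the smaller period `D`. -/
theorem occurs_lt_of_le_of_min (hW : HasMinPeriod W D) (hV : HasMinPeriod V d) (h0 : IsMinAt V 0)
    (hDd : D ≤ d) (hc : ¬ IsShiftOf V W) {l : ℤ} (hl : OccursUpTo V W l) : l < d := by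
  obtain ⟨a, ha⟩ := hl
  by_contra hcon
  push Not at hcon
  rcases hDd.lt_or_eq with h | h
  · obtain ⟨t, ht, ht1, ht2, -⟩ := h0.exists_lt hV hW.pos h
    exact ht2.ne (hW.period_on_occurrence ha t ht (by omega))
  · subst h
    exact hc ⟨a, eq_of_agree hW.pos hV.periodic (hW.shift a).periodic
      (fun t h1 h2 => ha t h1 (by omega))⟩

theorem occurs_lt_of_le (hW : HasMinPeriod W D) (hV : IsNiceWord V d r) (hDd : D ≤ d)
    (hc : ¬ IsShiftOf V W) {l : ℤ} (hl : OccursUpTo V W l) : l < d := by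
  rcases hV.extremal with h | h
  · exact occurs_lt_of_le_of_min hW hV.toHasMinPeriod h.1 hDd hc hl
  · exact occurs_lt_of_le_of_min hW.dual hV.toHasMinPeriod.dual h.1.dual hDd hc hl

/-- A run of `V` in `W` that ends by a rise is short: no maximal position of `W` lies in `[0, L]`
and no minimal one in `[d, L + d]`. If the run were longer than `D - r`, then the minimal position
would fall in `(0, d)`, where the beginning of `V` is smaller. -/
theorem run_le_of_rise (hW : HasMinPeriod W D) (hV : HasMinPeriod V d)
    (h0 : IsMinAt V 0) (hm : IsMinAt W m) (hM : IsMaxAt W M) {L : ℤ} (hL : 0 ≤ L)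
    (hM0 : M < 0) (hM1 : -D ≤ M) (hr : M + r ≤ m) (hr' : m ≤ M + D - r)
    (hVW : ∀ t, 0 ≤ t → t < L + d → W t = V t)
    (hrun : ∀ t, 0 ≤ t → t < L → W t = W (t + d)) (hlt : W L < W (L + d)) :
    L ≤ D - r := by
  by_contra hcon
  push Not at hcon
  have hd := hV.pos
  have hMD : IsMaxAt W (M + D) := by simpa using hM.add_mul hW 1
  have h1 : L < M + D := by
    by_contra h1
    exact absurd hlt (not_lt.mpr (hMD d L (by omega) (fun s h2 h3 => hrun s (by omega) h3)))
  have h2 : m < d := by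
    by_contra h2
    have := hm (-d) (L + d) (by omega) (fun s h3 h4 => by
      have := hrun (s + -d) (by omega) (by omega)
      rw [this]; congr 1; ring)
    rw [show L + d + -d = L by ring] at this
    exact absurd hlt (not_lt.mpr this)
  obtain ⟨t, ht0, ht1, ht2, ht3⟩ := h0.exists_lt hV (c := m) (by omega) h2
  have := hm (-m) (t + m) (by omega) (fun s h4 h5 => by
    rw [hVW s (by omega) (by omega), hVW (s + -m) (by omega) (by omega),
      ht3 (s + -m) (by omega) (by omega)]
    congr 1; ring)
  rw [show t + m + -m = t by ring, hVW t (by omega) (by omega),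
    hVW (t + m) (by omega) (by omega)] at this
  exact absurd ht2 (not_lt.mpr this)

/-- A run of `V` in `W` that ends by a fall and is longer than the bound `D - r`: no minimal
position of `W` lies in `[0, L]` and no maximal one in `[d, L + d]`, so that the maximal position
lies in `(0, d)`, in fact at most `ρ` letters after the beginning of the run. -/
theorem run_bounds_of_fall (hW : HasMinPeriod W D) (hV : HasMinPeriod V d) (hdD : d < D)
    (h0 : IsMinAt V 0) (hρ : IsMaxAt V ρ) (hρ0 : 0 ≤ ρ) (hρd : 2 * ρ ≤ d)
    (hm : IsMinAt W m) (hM : IsMaxAt W M) {L : ℤ}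
    (hm0 : m < 0) (hm1 : -D ≤ m) (hr : m + r ≤ M) (hr' : M ≤ m + D - r)
    (hVW : ∀ t, 0 ≤ t → t < L + d → W t = V t)
    (hrun : ∀ t, 0 ≤ t → t < L → W t = W (t + d)) (hlt : W (L + d) < W L) (hrD : 2 * r ≤ D)
    (hcon : D - r < L) :
    L + r < D + ρ ∧ 2 * d + r ≤ D + ρ ∧ (D < L + d → r < m + D - M ∧
      ∀ s u, (∀ t, 0 ≤ t → t < u → V (s + t) = W (m + t)) → u ≤ d) := by
  have hd := hV.pos
  have hmD : IsMinAt W (m + D) := by simpa using hm.add_mul hW 1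
  have h1 : L < m + D := by
    by_contra h1
    exact absurd hlt (not_lt.mpr (hmD d L (by omega) (fun s h2 h3 => hrun s (by omega) h3)))
  have h2 : M < d := by
    by_contra h2
    have := hM (-d) (L + d) (by omega) (fun s h3 h4 => by
      have := hrun (s + -d) (by omega) (by omega)
      rw [this]; congr 1; ring)
    rw [show L + d + -d = L by ring] at this
    exact absurd hlt (not_lt.mpr this)
  -- beyond `ρ` the maximal position of `V` would beat `M`
  have h3 : M ≤ ρ := by
    by_contra h3
    obtain ⟨t, ht0, ht1, ht2, ht3⟩ := hρ.exists_gt hV (c := M - ρ) (by omega) (by omega)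
    have := hM (ρ - M) (t + (M - ρ)) (by omega) (fun s h4 h5 => by
      rw [hVW s (by omega) (by omega), hVW (s + (ρ - M)) (by omega) (by omega),
        ht3 (s + (ρ - M)) (by omega) (by omega)]
      congr 1; ring)
    rw [show t + (M - ρ) + (ρ - M) = t by ring, hVW t (by omega) (by omega),
      hVW (t + (M - ρ)) (by omega) (by omega)] at this
    exact absurd ht2 (not_lt.mpr this)
  -- otherwise the fall at the end of the run is a rise relative to `M`, shifted by `D - d`
  have h4 : L + d < D + M := by
    by_contra h4
    have := hM (D - d) (L + d - D) (by omega) (fun s h5 h6 => by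
      have h7 := hrun (s + (D - d)) (by omega) (by omega)
      rw [h7, show s + (D - d) + d = s + D by ring, hW.periodic])
    have h8 := hW.periodic (L + d - D)
    rw [show L + d - D + D = L + d by ring] at h8
    rw [← h8, show L + d - D + (D - d) = L by ring] at this
    exact absurd hlt (not_lt.mpr this)
  have hWb : W (L + d) < V (L + d) := by
    rw [hV.periodic, ← hVW L (by omega) (by omega)]; exact hlt
  have hx : 2 * d ≤ m + D := by
    by_contra hx
    -- `m + D = d + c` with `0 < c < d`: by minimality of `m` the prefix of `V` has period `c` up to
    -- the end of the run, and then rises at a position `h ≥ M`, so `M` is not maximal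
    have hc0 : 0 < m + D - d := by omega
    obtain ⟨h, hh0, hh1, hh2, hh3⟩ := h0.exists_lt hV hc0 (by omega)
    set c := m + D - d with hc
    have hg : L - c ≤ h := by
      by_contra hg
      have := hmD (-(m + D)) (h + (m + D)) (by omega) (fun s h4 h5 => by
        have h6 := hh3 (s - (m + D)) (by omega) (by omega)
        have h7 := hV.periodic (s - (m + D) + c)
        rw [show s - (m + D) + c + d = s by omega] at h7
        rw [hVW s (by omega) (by omega), hVW (s + -(m + D)) (by omega) (by omega), h7, ← h6,
          sub_eq_add_neg])
      have h7 := hV.periodic (h + c)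
      rw [show h + c + d = h + (m + D) by omega] at h7
      rw [show h + (m + D) + -(m + D) = h by ring, hVW h (by omega) (by omega),
        hVW (h + (m + D)) (by omega) (by omega), h7] at this
      exact absurd hh2 (not_lt.mpr this)
    have := hM c h (by omega) (fun s h4 h5 => by
      rw [hVW s (by omega) (by omega), hVW (s + c) (by omega) (by omega)]
      exact hh3 s (by omega) h5)
    rw [hVW h (by omega) (by omega), hVW (h + c) (by omega) (by omega)] at this
    exact absurd hh2 (not_lt.mpr this)
  refine ⟨by omega, by omega, fun hD => ⟨by omega, fun s u hu => ?_⟩⟩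
  by_contra hud
  push Not at hud
  -- one period of `W` from `m` on lies between `V` and `W` from `0` on, which agree; so it is `V`,
  -- and as `-m < d` this makes the minimal rotation of `V` bordered
  have heq : ∀ n : ℕ, (n : ℤ) < d → V n = W (m + n) := by
    intro n
    induction n using Nat.strong_induction_on with
    | _ n ih =>
      intro hn
      have h5 : ∀ t, 0 ≤ t → t < (n : ℤ) → V t = W (m + t) := fun t h6 h7 => by
        have := ih t.toNat (by omega) (by omega)
        rwa [Int.toNat_of_nonneg h6] at this
      refine le_antisymm ?_ ?_
      · rw [← hu n (by omega) (by omega), add_comm s]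
        refine h0 s n (by omega) (fun t h6 h7 => ?_)
        rw [h5 t h6 h7, ← hu t h6 (by omega), add_comm]
      · have := hm (-m) (m + n) (by omega) (fun t h6 h7 => by
          have h8 := h5 (t - m) (by omega) (by omega)
          rw [show m + (t - m) = t by ring] at h8
          rw [← h8, hVW (t + -m) (by omega) (by omega), sub_eq_add_neg])
        rwa [show m + (n : ℤ) + -m = n by ring, hVW n (by omega) (by omega)] at this
  obtain ⟨t, ht0, ht1, ht2, -⟩ := h0.exists_lt hV (c := -m) (by omega) (by omega)
  have h5 := heq (t + -m).toNat (by omega)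
  rw [Int.toNat_of_nonneg (by omega), show m + (t + -m) = t by ring,
    hVW t (by omega) (by omega)] at h5
  exact ht2.ne h5.symm

/-- The case in which `V` is read from its minimal rotation; see `occurs_down`. -/
theorem occurs_down_of_min (hW : IsNiceWord W D r) (hV : HasMinPeriod V d) (hdD : d < D)
    (h0 : IsMinAt V 0) (hρ : IsMaxAt V ρ) (hρ0 : 0 ≤ ρ) (hρd : 2 * ρ ≤ d) {l : ℤ}
    (hl : OccursUpTo V W l) :
    l + r ≤ D + d ∨ (l + r ≤ D + d + ρ ∧ 2 * d + r ≤ D + ρ ∧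
      (l ≤ D ∨ ∀ u, OccursUpTo W V u → u ≤ d)) := by
  by_contra hcon
  have hlr : D + d < l + r := by
    by_contra h; exact hcon (Or.inl (not_lt.mp h))
  obtain ⟨a, ha⟩ := hl
  have hd := hV.pos
  have hD := hW.pos
  have hr0 := hW.nonneg
  have hrD := hW.two_mul_le
  set W' : ℤ → α := fun n => W (a + n) with hW'
  have hP : HasMinPeriod W' D := hW.toHasMinPeriod.shift a
  -- extend the occurrence to a maximal run of period `d`, which ends before `b + d`
  obtain ⟨b, hb0, hbne, hbs⟩ := hP.exists_break (hP.minimal d hd hdD) 0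
  have hb : l - d ≤ b := by
    by_contra hb
    apply hbne
    have h1 := ha b hb0 (by omega)
    have h2 := ha (b + d) (by omega) (by omega)
    simp only [hW']
    rw [h1, h2, hV.periodic]
  have hVW : ∀ t, 0 ≤ t → t < b + d → W' t = V t := by
    intro t
    induction h : t.toNat using Nat.strong_induction_on generalizing t with
    | _ n ih =>
      intro h1 h2
      rcases lt_or_ge t l with h3 | h3
      · exact ha t h1 h3
      · have h4 := hbs (t - d) (by omega) (by omega)
        have h5 := ih (t - d).toNat (by omega) (t - d) rfl (by omega) (by omega)
        rw [sub_add_cancel] at h4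
        rw [← h4, h5, ← hV.periodic, sub_add_cancel]
  -- positions of the extremal rotations, brought to the left of the occurrence
  obtain ⟨k, hk0, hk1⟩ : ∃ k : ℤ, -a + k * D < 0 ∧ -D ≤ -a + k * D := by
    refine ⟨-((-a) / D) - 1, ?_, ?_⟩ <;>
    · have h1 := Int.emod_add_mul_ediv (-a) D
      have h2 := Int.emod_lt_of_pos (-a) hD
      have h3 := Int.emod_nonneg (-a) hD.ne'
      nlinarith
  obtain ⟨k', hk0', hk1'⟩ : ∃ k : ℤ, r - a + k * D < 0 ∧ -D ≤ r - a + k * D := by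
    refine ⟨-((r - a) / D) - 1, ?_, ?_⟩ <;>
    · have h1 := Int.emod_add_mul_ediv (r - a) D
      have h2 := Int.emod_lt_of_pos (r - a) hD
      have h3 := Int.emod_nonneg (r - a) hD.ne'
      nlinarith
  rcases lt_or_gt_of_ne hbne with hlt | hgt
  · -- rise
    have : b ≤ D - r := by
      rcases hW.extremal with ⟨hm, hM⟩ | ⟨hM, hm⟩
      · have hM' := (hM.shift a).add_mul hP k'
        have hm' := (hm.shift a).add_mul hP (k' + 1)
        exact run_le_of_rise hP hV h0 hm' hM' hb0 hk0' hk1' (by linarith) (by linarith) hVW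
          hbs hlt
      · have hM' := (hM.shift a).add_mul hP k
        have hm' := (hm.shift a).add_mul hP k
        exact run_le_of_rise hP hV h0 hm' hM' hb0 (by linarith) (by linarith)
          (by linarith) (by linarith) hVW hbs hlt
    omega
  · apply hcon
    right
    rcases hW.extremal with ⟨hm, hM⟩ | ⟨hM, hm⟩
    · have hM' := (hM.shift a).add_mul hP k
      have hm' := (hm.shift a).add_mul hP k
      obtain ⟨h1, h2, h3⟩ := run_bounds_of_fall hP hV hdD h0 hρ hρ0 hρd hm' hM'
        (r := r) (by linarith) (by linarith) (by linarith) (by linarith) hVW hbs hgt hrD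
        (by omega)
      refine ⟨by omega, h2, or_iff_not_imp_left.mpr fun h4 u ⟨s, hs⟩ => ?_⟩
      refine (h3 (by omega)).2 s u (fun t h5 h6 => ?_)
      rw [hs t h5 h6, ← hW.toHasMinPeriod.add_mul t k]
      simp only [hW']
      congr 1; ring
    · have hM' := (hM.shift a).add_mul hP (k' + 1)
      have hm' := (hm.shift a).add_mul hP k'
      obtain ⟨h1, h2, h3⟩ := run_bounds_of_fall hP hV hdD h0 hρ hρ0 hρd hm' hM'
        (r := r) (by linarith) (by linarith) (by linarith) (by linarith) hVW hbs hgt hrD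
        (by omega)
      refine ⟨by omega, h2, Or.inl ?_⟩
      by_contra h4
      have := (h3 (by omega)).1
      linarith

/-- Overlap of a word `W` with a word `V` of smaller period, improving on `occurs_lt_add` when `r`
is large: a long run of period `d` in `W` forces its extremal rotations to start close to each
other. The exceptional case needs `D` to be about `2 * d` or more, and then one of the overlaps in
the two directions is at most the period of its left word. -/
theorem occurs_down (hW : IsNiceWord W D r) (hV : IsNiceWord V d ρ) (hdD : d < D) {l : ℤ}
    (hl : OccursUpTo V W l) :
    l + r ≤ D + d ∨ (l + r ≤ D + d + ρ ∧ 2 * d + r ≤ D + ρ ∧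
      (l ≤ D ∨ ∀ u, OccursUpTo W V u → u ≤ d)) := by
  rcases hV.extremal with h | h
  · exact occurs_down_of_min hW hV.toHasMinPeriod hdD h.1 h.2 hV.nonneg hV.two_mul_le hl
  · exact occurs_down_of_min hW.dual hV.toHasMinPeriod.dual hdD h.1.dual h.2.dual hV.nonneg
      hV.two_mul_le hl

end PeriodicWords

/-! ### Overlap bounds around a cycle -/

section Numeric

/-- The inequalities satisfied by the overlap `o` on an edge from a string of period `a` to a string
of period `b`, where `ra` and `rb` are the distances between the extremal rotations. The three cases
are those of `occurs_lt_of_le` and `occurs_down`. -/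
structure EdgeBound (a ra b rb o : ℤ) : Prop where
  le_add : o ≤ a + rb
  cases : (a ≤ b ∧ o ≤ b) ∨ (b ≤ a ∧ o + ra ≤ a + b) ∨
    (b ≤ a ∧ o + ra ≤ a + b + rb ∧ 2 * b + ra ≤ a + rb)

/-- A cycle of two vertices, starting at the one of larger period `a`. Here the exceptional case of
`occurs_down` is needed in full. -/
theorem two_cycle_bound {a ra b rb o₁ o₂ M : ℤ} (h1 : EdgeBound a ra b rb o₁)
    (ha : 2 * ra ≤ a) (hb : 2 * rb ≤ b)
    (h2 : o₂ ≤ b + ra) (h2' : o₂ ≤ a)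
    (h3 : o₁ + ra ≤ a + b ∨ (o₁ + ra ≤ a + b + rb ∧ (o₁ ≤ a ∨ o₂ ≤ b)))
    (hM2 : M ≤ o₂) : 7 * (o₁ + o₂) + 2 * M ≤ 11 * (a + b) := by
  have := h1.le_add
  rcases h3 with h3 | ⟨h3, h3 | h3⟩
  -- below `3 * b = 2 * a`, add up the bounds that contain `ra`; above, use `o₁ ≤ a + rb` and
  -- `o₂ ≤ a`; in the exceptional case, `o₁ ≤ a` takes over for `b` between `a / 4` and `6 * a / 17`
  · rcases le_total (3 * b) (2 * a) with h | h <;> linarith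
  · rcases le_total (3 * b) a with h | h <;> linarith
  · linarith

/-- A cycle of three vertices, starting at one of largest period `a`, so that the closing edge has
overlap at most `a`; likewise for the next two lemmas. -/
theorem three_cycle_bound {a ra b rb c rc o₁ o₂ o₃ M : ℤ}
    (h1 : EdgeBound a ra b rb o₁) (h2 : EdgeBound b rb c rc o₂) (h3 : o₃ ≤ c + ra)
    (h3' : o₃ ≤ a) (hb' : b ≤ a)
    (ha : 2 * ra ≤ a) (hb : 2 * rb ≤ b) (hc : 2 * rc ≤ c)
    (hM2 : M ≤ o₂) (hM3 : M ≤ o₃) :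
    7 * (o₁ + o₂ + o₃) + 2 * M ≤ 11 * (a + b + c) := by
  obtain ⟨k1, e1⟩ := h1
  obtain ⟨k2, e2⟩ := h2
  rcases e1 with ⟨p1, q1⟩ | ⟨p1, q1⟩ | ⟨p1, q1, s1⟩ <;>
  rcases e2 with ⟨p2, q2⟩ | ⟨p2, q2⟩ | ⟨p2, q2, s2⟩ <;> linarith

theorem four_cycle_bound {a ra b rb c rc d rd o₁ o₂ o₃ o₄ M : ℤ}
    (h1 : EdgeBound a ra b rb o₁) (h2 : EdgeBound b rb c rc o₂) (h3 : EdgeBound c rc d rd o₃)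
    (h4 : o₄ ≤ d + ra) (h4' : o₄ ≤ a)
    (ha : 2 * ra ≤ a) (hb : 2 * rb ≤ b) (hc : 2 * rc ≤ c) (hd : 2 * rd ≤ d)
    (hM2 : M ≤ o₂) (hM3 : M ≤ o₃) (hM4 : M ≤ o₄) :
    7 * (o₁ + o₂ + o₃ + o₄) + 2 * M ≤ 11 * (a + b + c + d) := by
  obtain ⟨k1, e1⟩ := h1
  obtain ⟨k2, e2⟩ := h2
  obtain ⟨k3, e3⟩ := h3
  rcases e1 with ⟨p1, q1⟩ | ⟨p1, q1⟩ | ⟨p1, q1, s1⟩ <;>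
  rcases e2 with ⟨p2, q2⟩ | ⟨p2, q2⟩ | ⟨p2, q2, s2⟩ <;>
  rcases e3 with ⟨p3, q3⟩ | ⟨p3, q3⟩ | ⟨p3, q3, s3⟩ <;> linarith

/-- Here the refined bounds are needed on the first two edges only. -/
theorem five_cycle_bound {a ra b rb c rc d rd e re o₁ o₂ o₃ o₄ o₅ M : ℤ}
    (h1 : EdgeBound a ra b rb o₁) (h2 : EdgeBound b rb c rc o₂) (h3 : o₃ ≤ c + rd)
    (h4 : o₄ ≤ d + re) (h5 : o₅ ≤ e + ra) (h5' : o₅ ≤ a)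
    (hc' : c ≤ a)
    (ha : 2 * ra ≤ a) (hb : 2 * rb ≤ b) (hc : 2 * rc ≤ c) (hd : 2 * rd ≤ d) (he : 2 * re ≤ e)
    (hM2 : M ≤ o₂) (hM3 : M ≤ o₃) (hM4 : M ≤ o₄) (hM5 : M ≤ o₅) :
    7 * (o₁ + o₂ + o₃ + o₄ + o₅) + 2 * M ≤ 11 * (a + b + c + d + e) := by
  obtain ⟨k1, e1⟩ := h1
  obtain ⟨k2, e2⟩ := h2
  rcases e1 with ⟨p1, q1⟩ | ⟨p1, q1⟩ | ⟨p1, q1, s1⟩ <;>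
  rcases e2 with ⟨p2, q2⟩ | ⟨p2, q2⟩ | ⟨p2, q2, s2⟩ <;> linarith

/-- Edge weights `f` on `V` that obey the overlap bounds for strings of periods `d`, with distances
`r` between the extremal rotations. -/
structure OverlapBounds {β : Type*} (V : Finset β) (d r : β → ℤ) (f : β → β → ℕ) : Prop where
  two_mul_le : ∀ i ∈ V, 2 * r i ≤ d i
  le_add : ∀ i ∈ V, ∀ j ∈ V, i ≠ j → (f i j : ℤ) ≤ d i + r j
  le_of_le : ∀ i ∈ V, ∀ j ∈ V, i ≠ j → d i ≤ d j → (f i j : ℤ) ≤ d j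
  of_lt : ∀ i ∈ V, ∀ j ∈ V, i ≠ j → d j < d i →
    f i j + r i ≤ d i + d j ∨ (f i j + r i ≤ d i + d j + r j ∧ 2 * d j + r i ≤ d i + r j ∧
      (f i j ≤ d i ∨ f j i ≤ d j))

theorem OverlapBounds.edgeBound {β : Type*} {V : Finset β} {d r : β → ℤ} {f : β → β → ℕ}
    (h : OverlapBounds V d r f) {i j : β} (hi : i ∈ V) (hj : j ∈ V) (hij : i ≠ j) :
    EdgeBound (d i) (r i) (d j) (r j) (f i j) := by
  refine ⟨h.le_add i hi j hj hij, ?_⟩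
  rcases le_or_gt (d i) (d j) with h1 | h1
  · exact Or.inl ⟨h1, h.le_of_le i hi j hj hij h1⟩
  · rcases h.of_lt i hi j hj hij h1 with h2 | h2
    · exact Or.inr (Or.inl ⟨h1.le, h2⟩)
    · exact Or.inr (Or.inr ⟨h1.le, h2.1, h2.2.1⟩)

theorem minEdge_le {β : Type*} (f : β → β → ℕ) {C : Cycle β} {e : β × β} (he : e ∈ edges C) :
    minEdge f C ≤ f e.1 e.2 :=
  Nat.sInf_le ⟨e, he, rfl⟩

theorem edges_coe {β : Type*} (l : List β) :
    edges (l : Cycle β) = ((l.zip (l.rotate 1) : List (β × β)) : Multiset (β × β)) := rfl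

theorem cycleWeight_coe {β : Type*} (f : β → β → ℕ) (l : List β) :
    cycleWeight f (l : Cycle β) = ((l.zip (l.rotate 1)).map fun e => f e.1 e.2).sum := by
  simp [cycleWeight, edges_coe]

theorem ne_of_mem_zip_rotate {β : Type*} {l : List β} (hl : l.Nodup) (h2 : 2 ≤ l.length)
    {e : β × β} (he : e ∈ l.zip (l.rotate 1)) : e.1 ∈ l ∧ e.2 ∈ l ∧ e.1 ≠ e.2 := by
  obtain ⟨i, hi, rfl⟩ := List.mem_iff_getElem.mp he
  simp only [List.getElem_zip, List.getElem_rotate]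
  refine ⟨List.getElem_mem _, List.getElem_mem _, fun h => ?_⟩
  rw [hl.getElem_inj_iff] at h
  simp only [List.length_zip, List.length_rotate, min_self] at hi
  rcases Nat.lt_or_ge (i + 1) l.length with h3 | h3
  · rw [Nat.mod_eq_of_lt h3] at h; omega
  · rw [show i + 1 = l.length by omega, Nat.mod_self] at h; omega

/-- For at least six vertices, `le_add` suffices: the weights sum to at most `3 / 2` of the periods,
and the smallest is at most a sixth of their sum. -/
theorem OverlapBounds.long_cycle {β : Type*} {V : Finset β} {d r : β → ℤ} {f : β → β → ℕ}
    (h : OverlapBounds V d r f) {l : List β} (hl : l.Nodup) (hV : ∀ v ∈ l, v ∈ V)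
    (h6 : 6 ≤ l.length) :
    7 * (cycleWeight f (l : Cycle β) : ℤ) + 2 * minEdge f (l : Cycle β) ≤
      11 * (l.map d).sum := by
  have hO : (cycleWeight f (l : Cycle β) : ℤ) ≤ (l.map d).sum + (l.map r).sum := by
    rw [← ((l.rotate_perm 1).map r).sum_eq, cycleWeight_coe]
    have h1 : (((l.zip (l.rotate 1)).map fun e => f e.1 e.2).sum : ℤ) ≤
        ((l.zip (l.rotate 1)).map fun e => d e.1 + r e.2).sum := by
      rw [Nat.cast_list_sum, List.map_map]
      refine List.sum_le_sum fun e he => ?_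
      obtain ⟨h1, h2, h3⟩ := ne_of_mem_zip_rotate hl (by omega) he
      exact h.le_add _ (hV _ h1) _ (hV _ h2) h3
    refine h1.trans_eq ?_
    rw [List.sum_map_add]
    have h2 := List.map_fst_zip (l₁ := l) (l₂ := l.rotate 1) (by simp)
    have h3 := List.map_snd_zip (l₁ := l) (l₂ := l.rotate 1) (by simp)
    conv_rhs => rw [← h3]
    conv_rhs => enter [1]; rw [← h2]
    simp [List.map_map, Function.comp_def]
  have hr : 2 * (l.map r).sum ≤ (l.map d).sum := by
    rw [← List.sum_map_mul_left]
    exact List.sum_le_sum fun v hv => h.two_mul_le v (hV v hv)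
  have hM : l.length * minEdge f (l : Cycle β) ≤ cycleWeight f (l : Cycle β) := by
    rw [cycleWeight_coe]
    have := List.card_nsmul_le_sum ((l.zip (l.rotate 1)).map fun e => f e.1 e.2)
      (minEdge f (l : Cycle β)) (fun x hx => by
        obtain ⟨e, he, rfl⟩ := List.mem_map.mp hx
        exact minEdge_le f (by rw [edges_coe]; exact he))
    simpa using this
  have hM6 : 6 * minEdge f (l : Cycle β) ≤ cycleWeight f (l : Cycle β) :=
    (Nat.mul_le_mul_right _ h6).trans hM
  zify at hM6
  linarith

theorem exists_coe_eq_of_max {β : Type*} [DecidableEq β] {C : Cycle β} (hC : C.Nontrivial)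
    (d : β → ℤ) : ∃ (a : β) (l : List β), ((a :: l : List β) : Cycle β) = C ∧
      ∀ b ∈ l, d b ≤ d a := by
  obtain ⟨x, -, -, hx, -⟩ := hC
  obtain ⟨a, ha, hmax⟩ := C.toFinset.exists_max_image d
    ⟨x, by rw [← Cycle.toFinset_toMultiset]; induction C using Quotient.inductionOn; simpa using hx⟩
  induction C using Quotient.inductionOn with
  | _ l =>
    change a ∈ l.toFinset at ha
    change ∀ b ∈ l.toFinset, _ at hmax
    rw [List.mem_toFinset] at ha
    obtain ⟨s, t, rfl⟩ := List.append_of_mem ha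
    refine ⟨a, t ++ s, ?_, fun b hb => hmax b ?_⟩
    · change ((a :: (t ++ s) : List β) : Cycle β) = ((s ++ a :: t : List β) : Cycle β)
      rw [Cycle.coe_eq_coe]
      exact (List.isRotated_append (l := s) (l' := a :: t)).symm
    · simp only [List.mem_append, List.mem_toFinset, List.mem_cons] at hb ⊢
      tauto

theorem OverlapBounds.cycle {β : Type*} [DecidableEq β] {V : Finset β} {d r : β → ℤ}
    {f : β → β → ℕ} (h : OverlapBounds V d r f) {C : Cycle β} (hC : C.Nodup)
    (hnt : C.Nontrivial) (hV : ∀ v ∈ C, v ∈ V) :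
    7 * (cycleWeight f C : ℤ) + 2 * minEdge f C ≤ 11 * ∑ v ∈ C.toFinset, d v := by
  obtain ⟨a, l, rfl, hmax⟩ := exists_coe_eq_of_max hnt d
  rw [Cycle.nodup_coe_iff] at hC
  have hsum : ∑ v ∈ Cycle.toFinset ((a :: l : List β) : Cycle β), d v =
      ((a :: l).map d).sum := by
    rw [Cycle.coe_toFinset, List.sum_toFinset d hC]
  rw [hsum]
  simp only [Cycle.mem_coe_iff] at hV
  rw [Cycle.nontrivial_coe_nodup_iff hC] at hnt
  have hM : ∀ e ∈ (a :: l).zip ((a :: l).rotate 1), minEdge f (a :: l : List β) ≤ f e.1 e.2 :=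
    fun e he => minEdge_le f (by rw [edges_coe]; exact he)
  rcases l with _ | ⟨b, _ | ⟨c, _ | ⟨x, _ | ⟨y, _ | ⟨z, l⟩⟩⟩⟩⟩
  · simp at hnt
  · simp only [cycleWeight_coe]
    simp at hM hC hmax hV ⊢
    obtain ⟨ha, hb⟩ := hV
    obtain ⟨hM1, hM2⟩ := hM
    have := two_cycle_bound (h.edgeBound ha hb hC) (h.two_mul_le a ha) (h.two_mul_le b hb)
      (h.le_add b hb a ha (Ne.symm hC)) (h.le_of_le b hb a ha (Ne.symm hC) hmax) (by
        rcases hmax.lt_or_eq with h1 | h1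
        · exact (h.of_lt a ha b hb hC h1).imp_right (fun h2 => ⟨h2.1, h2.2.2⟩)
        · have h2 := h.le_of_le a ha b hb hC h1.ge
          have h3 := h.two_mul_le a ha
          have h4 : (0 : ℤ) ≤ f a b := Int.natCast_nonneg _
          exact Or.inl (by linarith)) (Nat.cast_le.mpr hM2)
    linarith
  · simp only [cycleWeight_coe]
    simp at hM hC hmax hV ⊢
    obtain ⟨ha, hb, hc⟩ := hV
    obtain ⟨hM1, hM2, hM3⟩ := hM
    obtain ⟨⟨hab, hac⟩, hbc⟩ := hC
    have := three_cycle_bound (h.edgeBound ha hb hab) (h.edgeBound hb hc hbc)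
      (h.le_add c hc a ha (Ne.symm hac)) (h.le_of_le c hc a ha (Ne.symm hac) hmax.2) hmax.1
      (h.two_mul_le a ha) (h.two_mul_le b hb) (h.two_mul_le c hc)
      (Nat.cast_le.mpr hM2) (Nat.cast_le.mpr hM3)
    linarith
  · simp only [cycleWeight_coe]
    simp at hM hC hmax hV ⊢
    obtain ⟨ha, hb, hc, hx⟩ := hV
    obtain ⟨hM1, hM2, hM3, hM4⟩ := hM
    obtain ⟨⟨hab, -, hax⟩, ⟨hbc, -⟩, hcx⟩ := hC
    have := four_cycle_bound (h.edgeBound ha hb hab) (h.edgeBound hb hc hbc)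
      (h.edgeBound hc hx hcx)
      (h.le_add x hx a ha (Ne.symm hax)) (h.le_of_le x hx a ha (Ne.symm hax) hmax.2.2)
      (h.two_mul_le a ha) (h.two_mul_le b hb) (h.two_mul_le c hc) (h.two_mul_le x hx)
      (Nat.cast_le.mpr hM2) (Nat.cast_le.mpr hM3) (Nat.cast_le.mpr hM4)
    linarith
  · simp only [cycleWeight_coe]
    simp at hM hC hmax hV ⊢
    obtain ⟨ha, hb, hc, hx, hy⟩ := hV
    obtain ⟨hM1, hM2, hM3, hM4, hM5⟩ := hM
    obtain ⟨⟨hab, -, -, hay⟩, ⟨hbc, -⟩, ⟨hcx, -⟩, hxy⟩ := hC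
    have := five_cycle_bound (h.edgeBound ha hb hab) (h.edgeBound hb hc hbc)
      (h.le_add c hc x hx hcx) (h.le_add x hx y hy hxy)
      (h.le_add y hy a ha (Ne.symm hay)) (h.le_of_le y hy a ha (Ne.symm hay) hmax.2.2.2) hmax.2.1
      (h.two_mul_le a ha) (h.two_mul_le b hb) (h.two_mul_le c hc) (h.two_mul_le x hx)
      (h.two_mul_le y hy) (Nat.cast_le.mpr hM2) (Nat.cast_le.mpr hM3) (Nat.cast_le.mpr hM4)
      (Nat.cast_le.mpr hM5)
    linarith
  · exact h.long_cycle hC hV (by simp)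

end Numeric

/-! ### Cycles through the factors of a periodic word -/

section Positions

variable {α : Type*}

/-- The string `s` occurs in `W` at position `a`. -/
def OccursAt (W : ℤ → α) (s : List α) (a : ℤ) : Prop :=
  ∀ (t : ℕ) (ht : t < s.length), W (a + t) = s[t]

variable {W : ℤ → α} {s t : List α} {a b d : ℤ}

theorem OccursAt.prefix_of_le (hs : OccursAt W s a) (ht : OccursAt W t a)
    (h : s.length ≤ t.length) : s <+: t := by
  rw [List.prefix_iff_getElem]
  exact ⟨h, fun i hi => by rw [← hs i hi, ← ht i (hi.trans_le h)]⟩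

theorem OccursAt.drop (hs : OccursAt W s a) (k : ℕ) : OccursAt W (s.drop k) (a + k) := by
  intro i hi
  rw [List.getElem_drop, ← hs (k + i) (by rw [List.length_drop] at hi; omega)]
  push_cast
  congr 1; ring

theorem OccursAt.of_isPrefix (ht : OccursAt W t a) (h : s <+: t) : OccursAt W s a := by
  intro i hi
  rw [ht i (hi.trans_le h.length_le)]
  exact (h.getElem hi).symm

theorem OccursAt.of_isInfix (ht : OccursAt W t a) (h : s <:+: t) : ∃ b, OccursAt W s b := by
  obtain ⟨x, y, rfl⟩ := h
  rw [List.append_assoc] at ht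
  have := ht.drop x.length
  rw [List.drop_left] at this
  exact ⟨_, this.of_isPrefix (List.prefix_append _ _)⟩

theorem OccursAt.add_mul (hs : OccursAt W s a) (hW : ∀ n, W (n + d) = W n) (k : ℤ) :
    OccursAt W s (a + k * d) := by
  intro i hi
  have h1 : Function.Periodic W d := hW
  have h2 := h1.int_mul k (a + i)
  rw [← hs i hi, ← h2]
  congr 1
  push_cast
  ring

theorem prefLen_add_ovLen [DecidableEq α] (u v : List α) : prefLen u v + ovLen u v = u.length := by
  rw [prefLen, ovLen, ← List.length_append, pref_append_ov]

/-- The shift between the two occurrences is the length of the unmatched part of `s` for some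
overlap of `s` and `t`. -/
theorem prefLen_le_sub [DecidableEq α] (hs : OccursAt W s a) (ht : OccursAt W t b) (hab : a ≤ b)
    (h : ¬ t <:+: s) : (prefLen s t : ℤ) ≤ b - a := by
  have h1 := prefLen_add_ovLen s t
  obtain ⟨k, rfl⟩ := Int.le.dest hab
  rcases le_or_gt s.length k with hk | hk
  · omega
  · have h2 := hs.drop k
    rcases le_or_gt (s.drop k).length t.length with h3 | h3
    · have h4 := length_le_length_ov (List.drop_suffix k s) (h2.prefix_of_le ht h3)
      rw [List.length_drop] at h4
      unfold ovLen at h1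
      omega
    · exact absurd ((ht.prefix_of_le h2 h3.le).isInfix.trans (List.drop_suffix k s).isInfix) h

/-- Weights bounded by the increments of `p` telescope along a path ending in `z`. -/
theorem sum_zip_le {β : Type*} (w : β → β → ℕ) (p : β → ℤ) (G : ℤ) (z : β) (l : List β) :
    ∀ x, (x :: l).Pairwise (fun a b => (w a b : ℤ) ≤ p b - p a) →
      (∀ y ∈ x :: l, (w y z : ℤ) ≤ G - p y) →
      (((((x :: l).zip (l ++ [z])).map fun e => w e.1 e.2).sum : ℕ) : ℤ) ≤ G - p x := by
  induction l with
  | nil => intro x _ h; simpa using h x (by simp)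
  | cons y l ih =>
    intro x hp h
    have h1 := ih y hp.of_cons (fun v hv => h v (List.mem_cons_of_mem _ hv))
    have h2 := List.rel_of_pairwise_cons hp (List.mem_cons_self (a := y))
    simp only [List.cons_append, List.zip_cons_cons, List.map_cons, List.sum_cons, Nat.cast_add]
      at h1 ⊢
    linarith

/-- Strings that all occur in a word of period `d` lie on a cycle of weight at most `d` in the
prefix graph: visit them in the order of their positions modulo `d`. -/
theorem exists_cycle_of_occurs [DecidableEq α] (T : Finset (List α)) (hT : 2 ≤ T.card)
    (hsub : ∀ s ∈ T, ∀ t ∈ T, s <:+: t → s = t) (hd : 0 < d) (hW : ∀ n, W (n + d) = W n)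
    (hocc : ∀ s ∈ T, ∃ a, OccursAt W s a) :
    ∃ C : Cycle (List α), C.Nodup ∧ C.Nontrivial ∧ (∀ s, s ∈ C ↔ s ∈ T) ∧
      (cycleWeight prefLen C : ℤ) ≤ d := by
  have hocc' : ∀ s ∈ T, ∃ a, (0 ≤ a ∧ a < d) ∧ OccursAt W s a := fun s hs => by
    obtain ⟨a, ha⟩ := hocc s hs
    refine ⟨a % d, ⟨Int.emod_nonneg _ hd.ne', Int.emod_lt_of_pos _ hd⟩, ?_⟩
    have := ha.add_mul hW (-(a / d))
    rwa [show a + -(a / d) * d = a % d by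
      have := Int.emod_add_mul_ediv a d; linarith [mul_comm (a / d) d]] at this
  choose! p hp hpo using hocc'
  set l := T.toList.mergeSort (fun a b => decide (p a ≤ p b)) with hl
  have hperm : l.Perm T.toList := List.mergeSort_perm _ _
  have hmem : ∀ s, s ∈ l ↔ s ∈ T := fun s => by rw [hperm.mem_iff, Finset.mem_toList]
  have hnd : l.Nodup := hperm.nodup_iff.mpr T.nodup_toList
  have hlen : l.length = T.card := by rw [hperm.length_eq, Finset.length_toList]
  have hsorted : l.Pairwise (fun a b => p a ≤ p b) := by
    have := List.pairwise_mergeSort (le := fun a b => decide (p a ≤ p b))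
      (fun a b c h1 h2 => by simp only [decide_eq_true_eq] at *; exact h1.trans h2)
      (fun a b => by simpa using le_total (p a) (p b)) T.toList
    simpa using this
  have hpair : l.Pairwise (fun a b => (prefLen a b : ℤ) ≤ p b - p a) := by
    refine (hsorted.and hnd).imp_of_mem (fun {a b} ha hb h => ?_)
    rw [hmem] at ha hb
    exact prefLen_le_sub (hpo a ha) (hpo b hb) h.1 (fun h3 => h.2 (hsub b hb a ha h3).symm)
  refine ⟨l, Cycle.nodup_coe_iff.mpr hnd, ?_, fun s => by rw [Cycle.mem_coe_iff, hmem], ?_⟩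
  · rw [Cycle.nontrivial_coe_nodup_iff hnd]; omega
  rcases hlc : l with _ | ⟨x, _ | ⟨y, l'⟩⟩
  · rw [hlc] at hlen; simp at hlen; omega
  · rw [hlc] at hlen; simp at hlen; omega
  rw [hlc] at hpair hnd hmem
  have h1 := sum_zip_le prefLen p (p x + d) x l' y hpair.of_cons (fun v hv => by
    have hv' := (hmem v).mp (List.mem_cons_of_mem _ hv)
    have hx := (hmem x).mp List.mem_cons_self
    have h3 : OccursAt W x (p x + d) := by simpa using (hpo x hx).add_mul hW 1
    refine prefLen_le_sub (hpo v hv') h3 (by linarith [(hp v hv').2, (hp x hx).1]) (fun h4 => ?_)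
    rw [hsub x hx v hv' h4] at hnd
    exact (List.nodup_cons.mp hnd).1 hv)
  have h2 := List.rel_of_pairwise_cons hpair (List.mem_cons_self (a := y))
  rw [cycleWeight_coe]
  simp only [List.rotate_cons_succ, List.rotate_zero, List.cons_append, List.zip_cons_cons,
    List.map_cons, List.sum_cons, Nat.cast_add] at h1 ⊢
  linarith

end Positions

/-! ### Merging cycles of a minimum cycle cover -/

section Covers

variable {α : Type*} [DecidableEq α] {W : ℤ → α} {d : ℤ}

/-- Cycles of a minimum cycle cover whose strings all occur in a word of period `d` have total
weight at most `d`, because they could be merged into a single cycle. -/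
theorem IsMinCycleCover.sum_le_of_occurs {S : Finset (List α)} {𝒞 : Finset (Cycle (List α))}
    (hmin : IsMinCycleCover prefLen S 𝒞) (hsub : ∀ s ∈ S, ∀ t ∈ S, s <:+: t → s = t)
    {𝒜 : Finset (Cycle (List α))} (h𝒜 : 𝒜 ⊆ 𝒞) (hne : 𝒜.Nonempty) (hd : 0 < d)
    (hW : ∀ n, W (n + d) = W n) (hocc : ∀ C ∈ 𝒜, ∀ s ∈ C, ∃ a, OccursAt W s a) :
    ((∑ C ∈ 𝒜, cycleWeight prefLen C : ℕ) : ℤ) ≤ d := by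
  classical
  set T := S.filter (fun s => ∃ C ∈ 𝒜, s ∈ C) with hT
  have hmemT : ∀ C ∈ 𝒜, ∀ s ∈ C, s ∈ T := fun C hC s hs =>
    Finset.mem_filter.mpr ⟨(hmin.1.1 C (h𝒜 hC)).2.2 s hs, C, hC, hs⟩
  have hcard : 2 ≤ T.card := by
    obtain ⟨C, hC⟩ := hne
    obtain ⟨x, y, hxy, hx, hy⟩ := (hmin.1.1 C (h𝒜 hC)).2.1
    exact Finset.one_lt_card.mpr ⟨x, hmemT C hC x hx, y, hmemT C hC y hy, hxy⟩
  have hTS : ∀ s ∈ T, s ∈ S := fun s hs => (Finset.mem_filter.mp hs).1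
  obtain ⟨C', hnd, hnt, hmem, hle⟩ := exists_cycle_of_occurs T hcard
    (fun s hs t ht => hsub s (hTS s hs) t (hTS t ht)) hd hW (fun s hs => by
      obtain ⟨-, C, hC, hs⟩ := Finset.mem_filter.mp hs
      exact hocc C hC s hs)
  have hcov : IsCycleCover S (insert C' (𝒞 \ 𝒜)) := by
    refine ⟨fun C hC => ?_, fun v hv => ?_⟩
    · rcases Finset.mem_insert.mp hC with rfl | hC
      · exact ⟨hnd, hnt, fun v hv => hTS v ((hmem v).mp hv)⟩
      · exact hmin.1.1 C (Finset.mem_sdiff.mp hC).1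
    · obtain ⟨C, ⟨hC, hvC⟩, huniq⟩ := hmin.1.2 v hv
      by_cases hCA : C ∈ 𝒜
      · refine ⟨C', ⟨Finset.mem_insert_self _ _, (hmem v).mpr (hmemT C hCA v hvC)⟩, ?_⟩
        rintro D ⟨hD, hvD⟩
        rcases Finset.mem_insert.mp hD with h | hD
        · exact h
        · obtain ⟨hD1, hD2⟩ := Finset.mem_sdiff.mp hD
          exact absurd (huniq D ⟨hD1, hvD⟩ ▸ hCA) hD2
      · refine ⟨C, ⟨Finset.mem_insert_of_mem (Finset.mem_sdiff.mpr ⟨hC, hCA⟩), hvC⟩, ?_⟩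
        rintro D ⟨hD, hvD⟩
        rcases Finset.mem_insert.mp hD with rfl | hD
        · obtain ⟨-, E, hE, hvE⟩ := Finset.mem_filter.mp ((hmem v).mp hvD)
          exact absurd (huniq E ⟨h𝒜 hE, hvE⟩ ▸ hE) hCA
        · exact huniq D ⟨(Finset.mem_sdiff.mp hD).1, hvD⟩
  have h1 := hmin.2 _ hcov
  have h2 : coverWeight prefLen (insert C' (𝒞 \ 𝒜)) ≤
      cycleWeight prefLen C' + ∑ C ∈ 𝒞 \ 𝒜, cycleWeight prefLen C := by
    unfold coverWeight
    by_cases h : C' ∈ 𝒞 \ 𝒜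
    · rw [Finset.insert_eq_of_mem h]; exact Nat.le_add_left _ _
    · rw [Finset.sum_insert h]
  have h3 := Finset.sum_sdiff (f := cycleWeight (prefLen (α := α))) h𝒜
  unfold coverWeight at h1 h2
  omega

end Covers

/-! ### Nice rotations as periodic words -/

section Bridge

variable {α : Type*}

/-- The two-sided infinite word `… w w w …`, with `w` starting at position `0`. -/
def periodicWord (w : List α) (hw : w ≠ []) (n : ℤ) : α :=
  w[(n % w.length).toNat]'(by
    have h1 : (0 : ℤ) < w.length := by exact_mod_cast List.length_pos_iff.mpr hw
    have := Int.emod_lt_of_pos n h1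
    have := Int.emod_nonneg n h1.ne'
    omega)

variable {w : List α} (hw : w ≠ [])

theorem periodicWord_add_length (n : ℤ) :
    periodicWord w hw (n + w.length) = periodicWord w hw n := by
  simp [periodicWord]

theorem periodicWord_natCast (n : ℕ) :
    periodicWord w hw n = w[n % w.length]'(Nat.mod_lt _ (List.length_pos_iff.mpr hw)) := by
  simp only [periodicWord]
  congr 1

theorem occursAt_periodicWord_self : OccursAt (periodicWord w hw) w 0 := by
  intro t ht
  rw [zero_add, periodicWord_natCast]
  congr 1
  exact Nat.mod_eq_of_lt ht

theorem occursAt_flatten_replicate (n : ℕ) :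
    OccursAt (periodicWord w hw) (List.replicate n w).flatten 0 := by
  induction n with
  | zero => intro t ht; simp at ht
  | succ n ih =>
    intro t ht
    simp only [List.replicate_succ, List.flatten_cons] at ht ⊢
    rcases lt_or_ge t w.length with h | h
    · rw [List.getElem_append_left h]
      exact occursAt_periodicWord_self hw t h
    · rw [List.getElem_append_right h, ← ih (t - w.length) (by
        rw [List.length_append] at ht; omega)]
      conv_rhs => rw [← periodicWord_add_length]
      congr 1
      push_cast [h]
      ring

theorem occursAt_rotate (k : ℕ) : OccursAt (periodicWord w hw) (w.rotate k) k := by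
  intro t ht
  rw [List.getElem_rotate]
  have := periodicWord_natCast hw (k + t)
  push_cast at this
  rw [this]
  congr 2
  exact add_comm _ _

theorem getElem_le_of_le [LinearOrder α] {A B : List α} (h : A ≤ B) (k : ℕ) (hA : k < A.length)
    (hB : k < B.length) (hk : ∀ (i : ℕ) (hi : i < k), A[i] = B[i]) : A[k] ≤ B[k] := by
  induction k generalizing A B with
  | zero =>
    rcases A with _ | ⟨a, A⟩
    · simp at hA
    rcases B with _ | ⟨b, B⟩
    · simp at hB
    exact le_of_not_gt fun hab => absurd h (not_le.mpr (List.Lex.rel hab))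
  | succ k ih =>
    rcases A with _ | ⟨a, A⟩
    · simp at hA
    rcases B with _ | ⟨b, B⟩
    · simp at hB
    have h0 : a = b := hk 0 (by omega)
    subst h0
    exact ih (le_of_not_gt fun hab => absurd h (not_le.mpr (List.Lex.cons hab))) _ _
      (fun i hi => hk (i + 1) (by omega))

/-- Comparing the periodic word from `k` on with a shift amounts to comparing two rotations of `w`,
unless they agree over a full period. -/
theorem exists_rotation_of_agree (k : ℕ) {x b : ℤ} (hb : k ≤ b)
    (hs : ∀ s, (k : ℤ) ≤ s → s < b → periodicWord w hw s = periodicWord w hw (s + x)) :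
    periodicWord w hw b = periodicWord w hw (b + x) ∨
    ∃ z, z ~r w ∧ ∃ (i : ℕ) (h1 : i < (w.rotate k).length) (h2 : i < z.length),
      (∀ (j : ℕ) (hj : j < i), (w.rotate k)[j] = z[j]) ∧
      (w.rotate k)[i] = periodicWord w hw b ∧ z[i] = periodicWord w hw (b + x) := by
  have hl : 0 < w.length := List.length_pos_iff.mpr hw
  have hper := periodicWord_add_length hw
  obtain ⟨i, rfl⟩ := Int.le.dest hb
  by_cases hbk : i < w.length
  · right
    -- reduce the shifted position modulo the length to a natural number
    obtain ⟨y, hy⟩ : ∃ y : ℕ, (y : ℤ) = (k + x) % w.length :=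
      ⟨((k + x) % w.length).toNat, Int.toNat_of_nonneg (Int.emod_nonneg _ (by omega))⟩
    have hxy : ∀ t : ℤ, periodicWord w hw (k + t + x) = periodicWord w hw (y + t) := fun t => by
      simp only [periodicWord]
      congr 2
      rw [hy, Int.emod_add_emod]
      congr 1; ring
    refine ⟨w.rotate y, ⟨y, rfl⟩ |> List.IsRotated.symm, i, by rwa [List.length_rotate],
      by rwa [List.length_rotate], fun j hj => ?_, (occursAt_rotate hw k i _).symm, ?_⟩
    · rw [← occursAt_rotate hw k j, ← occursAt_rotate hw y j, ← hxy]
      exact hs _ (by omega) (by omega)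
    · rw [← occursAt_rotate hw y i, ← hxy]
  · left
    have h1 := eq_of_agree (V := fun n => periodicWord w hw (k + x + n))
      (W := fun n => periodicWord w hw (k + n)) (e := w.length) (by omega)
      (fun n => by rw [← add_assoc, hper]) (fun n => by rw [← add_assoc, hper])
      (fun t h2 h3 => by rw [hs (k + t) (by omega) (by omega)]; congr 1; ring) i
    rw [h1]; congr 1; ring

variable [LinearOrder α]

theorem isMinAt_periodicWord {k : ℕ} (h : ∀ z, z ~r w → w.rotate k ≤ z) :
    IsMinAt (periodicWord w hw) k := by
  intro x b hb hs
  rcases exists_rotation_of_agree hw k hb hs with h1 | ⟨z, hz, i, h1, h2, h3, h4, h5⟩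
  · exact h1.le
  · rw [← h4, ← h5]
    exact getElem_le_of_le (h z hz) i h1 h2 h3

theorem isMaxAt_periodicWord {k : ℕ} (h : ∀ z, z ~r w → z ≤ w.rotate k) :
    IsMaxAt (periodicWord w hw) k := by
  intro x b hb hs
  rcases exists_rotation_of_agree hw k hb hs with h1 | ⟨z, hz, i, h1, h2, h3, h4, h5⟩
  · exact h1.ge
  · rw [← h4, ← h5]
    exact getElem_le_of_le (h z hz) i h2 h1 (fun j hj => (h3 j hj).symm)

theorem IsNiceRotation.isNiceWord {u : List α} (h : IsNiceRotation u w)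
    (hp : HasMinPeriod (periodicWord w hw) w.length) :
    ∃ r, IsNiceWord (periodicWord w hw) w.length r := by
  obtain ⟨p, q, ⟨hpq, hmin⟩, ⟨hqp, hmax⟩, ⟨hle, rfl⟩ | ⟨hlt, rfl⟩⟩ := h
  · refine ⟨q.length, hp, by omega, by simp only [List.length_append]; omega, Or.inr ⟨?_, ?_⟩⟩
    · exact isMaxAt_periodicWord hw (k := 0) (fun z hz => by
        rw [List.rotate_zero]; exact hmax z (hz.trans hqp))
    · exact isMinAt_periodicWord hw (fun z hz => by
        rw [List.rotate_append_length_eq]; exact hmin z (hz.trans hqp))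
  · refine ⟨p.length, hp, by omega, by simp only [List.length_append]; omega, Or.inl ⟨?_, ?_⟩⟩
    · exact isMinAt_periodicWord hw (k := 0) (fun z hz => by
        rw [List.rotate_zero]; exact hmin z (hz.trans hpq))
    · exact isMaxAt_periodicWord hw (fun z hz => by
        rw [List.rotate_append_length_eq]; exact hmax z (hz.trans hpq))

theorem length_cycleString (l : List (List α)) :
    (cycleString l).length = cycleWeight prefLen (l : Cycle (List α)) := by
  rw [cycleWeight_coe, cycleString, List.length_flatten, List.zip, List.map_zipWith,
    List.map_zipWith]
  rfl

theorem IsNiceStringOf.length_eq {C : Cycle (List α)} {w : List α} (h : IsNiceStringOf C w) :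
    w.length = cycleWeight prefLen C := by
  obtain ⟨l, rfl, p, q, ⟨hpq, -⟩, ⟨hqp, -⟩, ⟨-, rfl⟩ | ⟨-, rfl⟩⟩ := h
  · rw [hqp.perm.length_eq, length_cycleString]
  · rw [hpq.perm.length_eq, length_cycleString]

end Bridge

/-! ### Representative strings of a minimum cycle cover -/

section Main

variable {α : Type*} [LinearOrder α] {S : Finset (List α)} {𝒞 : Finset (Cycle (List α))}

/-- All strings occur in the periodic repetition of a shortest superstring. -/
theorem IsMinCycleCover.coverWeight_le_OPT (hmin : IsMinCycleCover prefLen S 𝒞)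
    (hcard : 2 ≤ S.card) (hsub : ∀ s ∈ S, ∀ t ∈ S, s <:+: t → s = t) :
    coverWeight prefLen 𝒞 ≤ OPT S := by
  have hne : {n : ℕ | ∃ t : List α, t.length = n ∧ ∀ s ∈ S, s <:+: t}.Nonempty :=
    ⟨_, S.toList.flatten, rfl, fun s hs => List.infix_of_mem_flatten (Finset.mem_toList.mpr hs)⟩
  obtain ⟨t, ht, hSt⟩ := Nat.sInf_mem hne
  obtain ⟨a, ha, b, hb, hab⟩ := Finset.one_lt_card.mp hcard
  have ht0 : t ≠ [] := by
    rintro rfl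
    exact hab ((List.infix_nil.mp (hSt a ha)).trans (List.infix_nil.mp (hSt b hb)).symm)
  obtain ⟨C, ⟨hC, -⟩, -⟩ := hmin.1.2 a ha
  have := hmin.sum_le_of_occurs hsub (Finset.Subset.refl _) ⟨C, hC⟩
    (d := t.length) (by exact_mod_cast List.length_pos_iff.mpr ht0) (periodicWord_add_length ht0)
    (fun C hC s hs => (occursAt_periodicWord_self ht0).of_isInfix
      (hSt s ((hmin.1.1 C hC).2.2 s hs)))
  rw [OPT, ← ht]
  exact_mod_cast this

/-- A representative of `C` starts a periodic word whose least period is the weight of `C`. A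
smaller period would give a cycle of smaller weight through the same strings. -/
theorem IsMinCycleCover.exists_niceWord (hmin : IsMinCycleCover prefLen S 𝒞)
    (hsub : ∀ s ∈ S, ∀ t ∈ S, s <:+: t → s = t) {C : Cycle (List α)} (hC : C ∈ 𝒞)
    {x : List α} (hx : IsRepresentative C x) :
    ∃ (W : ℤ → α) (r : ℤ), IsNiceWord W (cycleWeight prefLen C) r ∧ OccursAt W x 0 ∧
      ∀ s ∈ C, ∃ a, OccursAt W s a := by
  obtain ⟨hsx, -, w, hnice, n, hn⟩ := hx
  have hw : w ≠ [] := by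
    rintro rfl
    rw [List.flatten_replicate_nil, List.prefix_nil] at hn
    subst hn
    obtain ⟨a, b, hab, ha, hb⟩ := (hmin.1.1 C hC).2.1
    exact hab ((List.infix_nil.mp (hsx a ha)).trans (List.infix_nil.mp (hsx b hb)).symm)
  have hx0 : OccursAt (periodicWord w hw) x 0 := (occursAt_flatten_replicate hw n).of_isPrefix hn
  have hocc : ∀ s ∈ C, ∃ a, OccursAt (periodicWord w hw) s a :=
    fun s hs => hx0.of_isInfix (hsx s hs)
  have hp : HasMinPeriod (periodicWord w hw) w.length := by
    refine ⟨by exact_mod_cast List.length_pos_iff.mpr hw, periodicWord_add_length hw,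
      fun e he hew => ?_⟩
    by_contra hcon
    push Not at hcon
    have := hmin.sum_le_of_occurs hsub (Finset.singleton_subset_iff.mpr hC)
      (Finset.singleton_nonempty C) he hcon (by simpa using hocc)
    rw [Finset.sum_singleton, ← hnice.length_eq] at this
    omega
  obtain ⟨l, -, hl⟩ := id hnice
  obtain ⟨r, hr⟩ := hl.isNiceWord hw hp
  exact ⟨_, r, hnice.length_eq ▸ hr, hx0, hocc⟩

/-- The strings of two different cycles of a minimum cycle cover do not all occur in the periodic
word of one of them. Hence representatives are distinct, and their periods are not conjugate. -/
theorem IsMinCycleCover.eq_of_occurs (hmin : IsMinCycleCover prefLen S 𝒞)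
    (hsub : ∀ s ∈ S, ∀ t ∈ S, s <:+: t → s = t) {C D : Cycle (List α)} (hC : C ∈ 𝒞) (hD : D ∈ 𝒞)
    {W : ℤ → α} (hpos : 0 < cycleWeight prefLen C)
    (hW : HasMinPeriod W (cycleWeight prefLen D)) (h1 : ∀ s ∈ C, ∃ a, OccursAt W s a)
    (h2 : ∀ s ∈ D, ∃ a, OccursAt W s a) : C = D := by
  classical
  by_contra hne
  have := hmin.sum_le_of_occurs hsub (𝒜 := {C, D}) (by
    intro E hE
    rcases Finset.mem_insert.mp hE with rfl | hE
    · exact hC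
    · rwa [Finset.mem_singleton.mp hE]) ⟨C, by simp⟩ hW.pos hW.periodic (by
      intro E hE
      rcases Finset.mem_insert.mp hE with rfl | hE
      · exact h1
      · rwa [Finset.mem_singleton.mp hE])
  rw [Finset.sum_pair hne] at this
  push_cast at this
  omega

/-- An overlap of `x` and `y` is a factor of the periodic word of `x` and a prefix of that of
`y`. -/
theorem occursUpTo_ovLen {V W : ℤ → α} {x y : List α} (hx : OccursAt W x 0) (hy : OccursAt V y 0) :
    OccursUpTo V W (ovLen x y) := by
  have h1 := ov_suffix x y
  rw [List.suffix_iff_eq_drop] at h1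
  have h2 := hx.drop (x.length - (ov x y).length)
  rw [← h1] at h2
  have h3 := hy.of_isPrefix (ov_prefix x y)
  refine ⟨0 + ((x.length - (ov x y).length : ℕ) : ℤ), fun t ht0 ht => ?_⟩
  obtain ⟨n, rfl⟩ := Int.eq_ofNat_of_zero_le ht0
  have hn : n < (ov x y).length := by unfold ovLen at ht; omega
  have h4 := h3 n hn
  rw [zero_add] at h4
  rw [h2 n hn, h4]

/-- The inequality holds for every cycle cover of the overlap graph of the representatives, without
any maximality. -/
theorem IsMinCycleCover.two_mul_totalMinOverlap_add_le (hmin : IsMinCycleCover prefLen S 𝒞)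
    (hcard : 2 ≤ S.card) (hsub : ∀ s ∈ S, ∀ t ∈ S, s <:+: t → s = t)
    {R : Cycle (List α) → List α} (hR : ∀ C ∈ 𝒞, IsRepresentative C (R C))
    {𝒟 : Finset (Cycle (List α))} (hD : IsCycleCover (𝒞.image R) 𝒟) :
    2 * totalMinOverlap 𝒟 + 7 * totalOverlap 𝒟 ≤ 11 * coverWeight prefLen 𝒞 := by
  classical
  have : Nonempty α := by
    obtain ⟨a, ha, b, hb, hab⟩ := Finset.one_lt_card.mp hcard
    rcases a with _ | ⟨x, a⟩
    · exact absurd (hsub _ ha _ hb List.nil_infix) hab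
    · exact ⟨x⟩
  choose! W r hnice hRocc hocc using fun C hC => hmin.exists_niceWord hsub hC (hR C hC)
  have hpos : ∀ C ∈ 𝒞, 0 < cycleWeight prefLen C := fun C hC => by
    have := (hnice C hC).pos; omega
  have hinj : Set.InjOn R 𝒞 := by
    intro C hC D hD hCD
    refine hmin.eq_of_occurs hsub hC hD (hpos C hC) (hnice D hD).toHasMinPeriod
      (fun s hs => ?_) (hocc D hD)
    have h1 := (hR C hC).1 s hs
    rw [hCD] at h1
    exact (hRocc D hD).of_isInfix h1
  have hconj : ∀ C ∈ 𝒞, ∀ D ∈ 𝒞, C ≠ D → ¬ IsShiftOf (W C) (W D) := by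
    rintro C hC D hD hne ⟨a, ha⟩
    refine hne (hmin.eq_of_occurs hsub hC hD (hpos C hC) (hnice D hD).toHasMinPeriod
      (fun s hs => ?_) (hocc D hD))
    obtain ⟨b, hb⟩ := hocc C hC s hs
    exact ⟨a + b, fun t ht => by rw [add_assoc, ha, hb t ht]⟩
  set g := Function.invFunOn R (𝒞 : Set (Cycle (List α))) with hg
  have hgR : ∀ C ∈ 𝒞, g (R C) = C := fun C hC => hinj.leftInvOn_invFunOn hC
  have hbounds : OverlapBounds (𝒞.image R) (fun x => cycleWeight prefLen (g x))
      (fun x => r (g x)) ovLen := by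
    constructor
    · simp only [Finset.forall_mem_image]
      intro C hC
      rw [hgR C hC]
      exact (hnice C hC).two_mul_le
    · simp only [Finset.forall_mem_image]
      intro C hC D hD hne
      rw [hgR C hC, hgR D hD]
      exact (occurs_lt_add (hnice C hC).toHasMinPeriod (hnice D hD)
        (hconj D hD C hC (fun h => hne (by rw [h])))
        (occursUpTo_ovLen (hRocc C hC) (hRocc D hD))).le
    · simp only [Finset.forall_mem_image]
      intro C hC D hD hne
      rw [hgR C hC, hgR D hD]
      intro hle
      exact (occurs_lt_of_le (hnice C hC).toHasMinPeriod (hnice D hD) hle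
        (hconj D hD C hC (fun h => hne (by rw [h])))
        (occursUpTo_ovLen (hRocc C hC) (hRocc D hD))).le
    · simp only [Finset.forall_mem_image]
      intro C hC D hD hne
      rw [hgR C hC, hgR D hD]
      intro hlt
      refine (occurs_down (hnice C hC) (hnice D hD) hlt
        (occursUpTo_ovLen (hRocc C hC) (hRocc D hD))).imp_right (fun h => ⟨h.1, h.2.1, ?_⟩)
      exact h.2.2.imp_right (fun h => h _ (occursUpTo_ovLen (hRocc D hD) (hRocc C hC)))
  have hmemF : ∀ (C : Cycle (List α)) x, x ∈ C.toFinset ↔ x ∈ C := fun C x => by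
    induction C using Quotient.inductionOn with
    | _ l => exact List.mem_toFinset
  have hunion : 𝒞.image R = 𝒟.biUnion Cycle.toFinset := by
    ext x
    rw [Finset.mem_biUnion]
    constructor
    · intro hx
      obtain ⟨D, ⟨hD, hxD⟩, -⟩ := hD.2 x hx
      exact ⟨D, hD, (hmemF D x).mpr hxD⟩
    · rintro ⟨D, hD', hxD⟩
      exact (hD.1 D hD').2.2 x ((hmemF D x).mp hxD)
  have hdisj : Set.PairwiseDisjoint (𝒟 : Set (Cycle (List α))) Cycle.toFinset := by
    intro C hC D hD' hne
    refine Finset.disjoint_left.mpr (fun x hxC hxD => hne ?_)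
    rw [hmemF] at hxC hxD
    exact (hD.2 x ((hD.1 C hC).2.2 x hxC)).unique ⟨hC, hxC⟩ ⟨hD', hxD⟩
  have hsum : ∑ C ∈ 𝒞, (cycleWeight prefLen C : ℤ) =
      ∑ D ∈ 𝒟, ∑ x ∈ D.toFinset, (cycleWeight prefLen (g x) : ℤ) := by
    rw [← Finset.sum_biUnion hdisj, ← hunion, Finset.sum_image hinj]
    exact Finset.sum_congr rfl (fun C hC => by rw [hgR C hC])
  have key := Finset.sum_le_sum (fun D hD' =>
    hbounds.cycle (hD.1 D hD').1 (hD.1 D hD').2.1 (hD.1 D hD').2.2)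
  rw [Finset.sum_add_distrib, ← Finset.mul_sum, ← Finset.mul_sum, ← Finset.mul_sum, ← hsum] at key
  unfold totalMinOverlap totalOverlap coverWeight
  zify
  linarith

end Main

end Superstring

theorem theorem2 {α : Type*} [LinearOrder α] (S : Finset (List α)) (hcard : 2 ≤ S.card)
    (hsub : ∀ s ∈ S, ∀ t ∈ S, s <:+: t → s = t)
    (Cmin : Finset (Cycle (List α)))
    (hmin : Superstring.IsMinCycleCover Superstring.prefLen S Cmin) :
    (∀ R : Cycle (List α) → List α, (∀ C ∈ Cmin, Superstring.IsRepresentative C (R C)) →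
      ∀ 𝒞 : Finset (Cycle (List α)),
        Superstring.IsMaxCycleCover Superstring.ovLen (Cmin.image R) 𝒞 →
        2 * Superstring.totalMinOverlap 𝒞 + 7 * Superstring.totalOverlap 𝒞 ≤
          11 * Superstring.coverWeight Superstring.prefLen Cmin) ∧
    11 * Superstring.coverWeight Superstring.prefLen Cmin ≤ 11 * Superstring.OPT S :=
  ⟨fun _ hR _ h𝒞 => hmin.two_mul_totalMinOverlap_add_le hcard hsub hR h𝒞.1,
    Nat.mul_le_mul_left 11 (hmin.coverWeight_le_OPT hcard hsub)⟩
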